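/- Let $n \ge 0$, let $R = \mathbb{C}[x_1,\dots,x_n]$, and let $G = ([n],E)$ be any (simple, undirected) graph with vertex set $[n] = \{1,\dots,n\}$. Let $\mathcal{A} = \mathcal{A}(G)$ be its graphic arrangement, given by the linear forms $f_{ij} = x_i - x_j$ for $\{i,j\} \in E$, $i<j$, and put $f = \prod_{\{i,j\}\in E,\, i<j} f_{ij}$. Let $$\mathrm{Der}(\mathcal{A}) = \{\theta \in \mathrm{Der}_{\mathbb{C}}(R) : \theta(f) \in \langle f\rangle\}.$$ Let $Q$ be the matrix over $R$ with rows indexed by $E$ which is the block matrix $Q = [\,\mathrm{diag}(f_e)_{e\in E} \mid (\partial f_e/\partial x_j)_{e \in E,\, j\in[n]}\,]$, let $\binom{A}{B}$ be a matrix whose columns generate $\ker Q$ (with $A$ having rows indexed by $E$ and $B$ having $n$ rows), and let $I_0(\mathcal{A}) = \langle (s_e)_{e\in E}\, A\rangle \subset R[s_e : e\in E]$ be the pre-likelihood ideal; it does not depend on the choice of generators. For a derivation $\theta$ of $R$, its value at the log-likelihood function $\ell_{\mathcal{A}} = \sum_{e\in E} s_e \log f_e$ is $\theta(\ell_{\mathcal{A}})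 = \sum_{e\in E} s_e\, \theta(f_e)/f_e$. For $k = 0,\dots,n-1$ let $\theta_k = \sum_{i=1}^n x_i^k\,\partial_{x_i}$ be Saito's derivations. A subset $T\subseteq[n]$ is a separator of $G$ if the induced subgraph $G\setminus T$ on $[n]\setminus T$ is disconnected. For a separator $T$ and a connected component $C$ of $G\setminus T$, the separator-based derivation is $$\theta_C^T = \sum_{i\in C}\ \prod_{t\in T}(x_i - x_t)\,\partial_{x_i}.$$ Theorem. The $R$-module $\mathrm{Der}(\mathcal{A}(G))$ is generated by $\theta_0,\dots,\theta_{n-1}$ together with the separator-based derivations $\theta_C^T$ (for all separators $T$ of $G$ and all connected components $C$ of $G\setminus T$). Moreover, $\theta(\ell_{\mathcal{A}})$ is a polynomial in $R[s_e : e\in E]$ for each of these derivations $\theta$, and the ideal $I_0(\mathcal{A}(G))$ is generated by the polynomials $\theta_k(\ell_{\mathcal{A}})$ and $\theta_C^T(\ell_{\mathcal{A}})$. -/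

import Mathlib

open MvPolynomial

namespace LikelihoodArrangement

/-! Arrangements of hypersurfaces given by a finite family `f` of polynomials in
`R = ℂ[x_1, …, x_n]`. -/

section General

variable {n : ℕ} {ι : Type*} [Fintype ι]

/-- The module `Der(𝒜)` of all `ℂ`-derivations `θ` of `R` with `θ(f) ∈ ⟨f⟩`, where `f` is the
product of the polynomials of the arrangement. -/
noncomputable def derModule (f : ι → MvPolynomial (Fin n) ℂ) :
    Submodule (MvPolynomial (Fin n) ℂ)
      (Derivation ℂ (MvPolynomial (Fin n) ℂ) (MvPolynomial (Fin n) ℂ)) where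
  carrier := {θ | θ (∏ i, f i) ∈ Ideal.span {∏ i, f i}}
  zero_mem' := by simp
  add_mem' := fun {θ η} hθ hη => by
    simpa only [Set.mem_ofPred_eq, Derivation.add_apply] using Ideal.add_mem _ hθ hη
  smul_mem' := fun c θ hθ => by
    simpa only [Set.mem_ofPred_eq, Derivation.smul_apply, smul_eq_mul]
      using Ideal.mul_mem_left _ c hθ

open Classical in
/-- The matrix `Q = [diag(f_1, …, f_m) | (∂f_i/∂x_j)]` with `m` rows and `m + n` columns. -/
noncomputable def matrixQ (f : ι → MvPolynomial (Fin n) ℂ) :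
    Matrix ι (ι ⊕ Fin n) (MvPolynomial (Fin n) ℂ) :=
  Matrix.fromCols (Matrix.diagonal f) (Matrix.of fun i j => pderiv j (f i))

/-- The log-derivation module: the projection of `ker Q` to the first `m` coordinates. Equivalently,
the image of the matrix `A` when the columns of the block matrix `(A ; B)` generate `ker Q`. -/
noncomputable def logDer (f : ι → MvPolynomial (Fin n) ℂ) :
    Submodule (MvPolynomial (Fin n) ℂ) (ι → MvPolynomial (Fin n) ℂ) :=
  (LinearMap.ker (matrixQ f).mulVecLin).map
    (LinearMap.funLeft (MvPolynomial (Fin n) ℂ) (MvPolynomial (Fin n) ℂ) Sum.inl)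

/-- The pre-likelihood ideal `I_0(𝒜) = ⟨(s_1, …, s_m) A⟩` in `R[s_1, …, s_m]`: it is generated by
the linear forms `∑ a_i s_i` for `a` in `im A`, so it does not depend on the choice of the
generators of `ker Q`. -/
noncomputable def preLikelihoodIdeal (f : ι → MvPolynomial (Fin n) ℂ) :
    Ideal (MvPolynomial ι (MvPolynomial (Fin n) ℂ)) :=
  Ideal.span {q | ∃ a ∈ logDer f, q = ∑ i, X i * C (a i)}

/-- The value `θ(ℓ) = ∑ s_i θ(f_i) / f_i` of a derivation `θ` of `R` at the log-likelihood function
`ℓ = ∑ s_i log(f_i)`. It is a polynomial in the `s_i` over the field of fractions of `R`. -/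
noncomputable def logLikelihoodDeriv (f : ι → MvPolynomial (Fin n) ℂ)
    (θ : Derivation ℂ (MvPolynomial (Fin n) ℂ) (MvPolynomial (Fin n) ℂ)) :
    MvPolynomial ι (FractionRing (MvPolynomial (Fin n) ℂ)) :=
  ∑ i, X i * C (algebraMap (MvPolynomial (Fin n) ℂ) (FractionRing (MvPolynomial (Fin n) ℂ)) (θ (f i))
    / algebraMap (MvPolynomial (Fin n) ℂ) (FractionRing (MvPolynomial (Fin n) ℂ)) (f i))

/-- The inclusion of `R[s]` in `Frac(R)[s]`. -/
noncomputable def toFrac (n : ℕ) (ι : Type*) :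
    MvPolynomial ι (MvPolynomial (Fin n) ℂ) →+*
      MvPolynomial ι (FractionRing (MvPolynomial (Fin n) ℂ)) :=
  MvPolynomial.map (algebraMap (MvPolynomial (Fin n) ℂ) (FractionRing (MvPolynomial (Fin n) ℂ)))

end General

section Graphic

variable {n : ℕ}

/-- The edges of a graph on `[n]`, each written as `(i, j)` with `i < j`. -/
abbrev OrientedEdge (G : SimpleGraph (Fin n)) : Type :=
  {e : Fin n × Fin n // e.1 < e.2 ∧ G.Adj e.1 e.2}

noncomputable instance (G : SimpleGraph (Fin n)) : Fintype (OrientedEdge G) :=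
  Fintype.ofFinite _

/-- The graphic arrangement `𝒜(G)`: the linear forms `x_i - x_j` for the edges `ij` of `G`. -/
noncomputable def graphicArrangement (G : SimpleGraph (Fin n)) :
    OrientedEdge G → MvPolynomial (Fin n) ℂ :=
  fun e => X e.1.1 - X e.1.2

/-- The derivation `θ_k = ∑ x_i ^ k ∂_i`. -/
noncomputable def saitoDerivation (n k : ℕ) :
    Derivation ℂ (MvPolynomial (Fin n) ℂ) (MvPolynomial (Fin n) ℂ) :=
  ∑ i : Fin n, (X i ^ k : MvPolynomial (Fin n) ℂ) • pderiv i

/-- `T` is a separator of `G` if the induced subgraph `G \ T` is disconnected. -/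
def IsSeparator (G : SimpleGraph (Fin n)) (T : Finset (Fin n)) : Prop :=
  ¬ (G.induce ((T : Set (Fin n))ᶜ)).Preconnected

open Classical in
/-- The derivation `θ_C^T = ∑_{i ∈ C} ∏_{t ∈ T} (x_i - x_t) ∂_i`, where `C` is a connected component
of `G \ T`. -/
noncomputable def separatorDerivation (G : SimpleGraph (Fin n)) (T : Finset (Fin n))
    (C : (G.induce ((T : Set (Fin n))ᶜ)).ConnectedComponent) :
    Derivation ℂ (MvPolynomial (Fin n) ℂ) (MvPolynomial (Fin n) ℂ) :=
  ∑ i : Fin n with i ∈ Subtype.val '' C.supp,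
    (∏ t ∈ T, (X i - X t : MvPolynomial (Fin n) ℂ)) • pderiv i

/-- The set of the derivations `θ_0, …, θ_{n-1}` and of all separator-based derivations of `G`. -/
def generatingDerivations (G : SimpleGraph (Fin n)) :
    Set (Derivation ℂ (MvPolynomial (Fin n) ℂ) (MvPolynomial (Fin n) ℂ)) :=
  {θ | ∃ k < n, θ = saitoDerivation n k} ∪
    {θ | ∃ T : Finset (Fin n), IsSeparator G T ∧ ∃ C, θ = separatorDerivation G T C}

end Graphic

end LikelihoodArrangement

namespace LikelihoodArrangement

/-! ### Finite sums of derivations and the Leibniz rule for products -/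

section Derivations

variable {R A M : Type*} [CommSemiring R] [CommSemiring A] [AddCommMonoid M] [Algebra R A]
  [Module A M] [Module R M]

/-! The forms `x_i - x_j` are pairwise non-associated primes, so `θ` lies in `Der(𝒜(G))` iff `x_i -
x_j ∣ θ(x_i) - θ(x_j)` for every edge. That such `θ` lie in the span follows by induction on adding
edges. For the complete graph, Newton interpolation at the nodes `x_i` writes `θ` through Saito's
derivations (`mem_span_saitoDerivation`). If `a`, `b` are not adjacent,
`exists_separator_correction` subtracts separator-based derivations until the divisibility also
holds for `ab`. The rest is in the span for `G + ab`, which lies in the span for `G`. The correction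
exists because, modulo `x_a - x_b` and in the coordinates `x_b - x_t`, the variables of each
monomial of `θ(x_b) - θ(x_a)` other than `x_b` form a separator of `a` and `b`. The ideal statement
follows since kernel vectors of `Q` are, up to sign, derivations `θ` with quotients `θ(f_e)/f_e`. -/

theorem derivation_sum_apply {κ : Type*} (s : Finset κ) (D : κ → Derivation R A M) (a : A) :
    (∑ k ∈ s, D k) a = ∑ k ∈ s, D k a := by
  classical
  induction s using Finset.induction_on with
  | empty => simp
  | insert k s hk ih => simp [Finset.sum_insert hk, ih]

theorem derivation_prod {κ : Type*} [DecidableEq κ] (s : Finset κ) (D : Derivation R A M)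
    (f : κ → A) : D (∏ k ∈ s, f k) = ∑ k ∈ s, (∏ j ∈ s.erase k, f j) • D (f k) := by
  induction s using Finset.induction_on with
  | empty => simp
  | insert k s hk ih =>
    rw [Finset.prod_insert hk, Finset.sum_insert hk, D.leibniz, ih, Finset.erase_insert hk,
      Finset.smul_sum, add_comm]
    congr 1
    refine Finset.sum_congr rfl fun i hi => ?_
    have hik : k ≠ i := fun h => hk (h ▸ hi)
    rw [Finset.erase_insert_of_ne hik, Finset.prod_insert (by simp [hk]), smul_smul]

end Derivations

/-! ### Divisibility by differences of variables -/

section Polynomials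

variable {σ : Type*}

/-- Modulo `x_a - x_b`, `φ` and the identity agree on the variables, hence everywhere. -/
theorem X_sub_X_dvd_sub_of_algHom {a b : σ}
    (φ : MvPolynomial σ ℂ →ₐ[ℂ] MvPolynomial σ ℂ)
    (h : ∀ i, (X a - X b : MvPolynomial σ ℂ) ∣ X i - φ (X i)) (p : MvPolynomial σ ℂ) :
    (X a - X b : MvPolynomial σ ℂ) ∣ p - φ p := by
  have key : (Ideal.Quotient.mkₐ ℂ (Ideal.span {(X a - X b : MvPolynomial σ ℂ)})) =
      (Ideal.Quotient.mkₐ ℂ (Ideal.span {(X a - X b : MvPolynomial σ ℂ)})).comp φ := by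
    refine MvPolynomial.algHom_ext fun i => ?_
    simpa [Ideal.Quotient.eq, Ideal.mem_span_singleton] using h i
  have := DFunLike.congr_fun key p
  simpa [Ideal.Quotient.eq, Ideal.mem_span_singleton] using this

open Classical in
theorem X_sub_X_dvd_iff {a b : σ} (p : MvPolynomial σ ℂ) :
    (X a - X b : MvPolynomial σ ℂ) ∣ p ↔ rename (Function.update id a b) p = 0 := by
  constructor
  · rintro ⟨q, rfl⟩
    by_cases h : b = a <;> simp [h]
  · intro h
    have := X_sub_X_dvd_sub_of_algHom (a := a) (b := b)
      (rename (Function.update id a b)) (fun i => ?_) p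
    · simpa [h] using this
    · rcases eq_or_ne i a with rfl | hi
      · simp
      · simp [hi]

theorem X_sub_X_ne_zero {a b : σ} (h : a ≠ b) : (X a - X b : MvPolynomial σ ℂ) ≠ 0 :=
  sub_ne_zero.mpr fun h' => h (X_injective h')

theorem prime_X_sub_X {a b : σ} (h : a ≠ b) : Prime (X a - X b : MvPolynomial σ ℂ) := by
  refine ⟨X_sub_X_ne_zero h, fun hu => ?_, fun p q hpq => ?_⟩
  · have := (X_sub_X_dvd_iff (a := a) (b := b) 1).mp hu.dvd
    simp at this
  · simpa [X_sub_X_dvd_iff] using hpq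

open Classical in
theorem X_sub_X_dvd_X_sub_X_iff {a b c d : σ} :
    (X a - X b : MvPolynomial σ ℂ) ∣ X c - X d ↔
      Function.update id a b c = Function.update id a b d := by
  rw [X_sub_X_dvd_iff, map_sub, rename_X, rename_X, sub_eq_zero, X_injective.eq_iff]

end Polynomials

/-- Newton interpolation: values `p i` at nodes `x i` with `x i - x j ∣ p i - p j` are interpolated
by a polynomial with coefficients in the ground ring, if the differences of the nodes are pairwise
coprime primes. -/
theorem exists_interpolating_polynomial {A ι : Type*} [CommRing A] [DecidableEq ι] (x : ι → A)
    (hx : ∀ i j, i ≠ j → Prime (x i - x j))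
    (hx' : ∀ i j k, i ≠ j → j ≠ k → i ≠ k → ¬ x i - x j ∣ x j - x k) (S : Finset ι) :
    ∀ p : ι → A, (∀ i ∈ S, ∀ j ∈ S, x i - x j ∣ p i - p j) →
      ∃ P : Polynomial A, P.degree < S.card ∧ ∀ i ∈ S, P.eval (x i) = p i := by
  induction S using Finset.induction_on with
  | empty => exact fun p _ => ⟨0, by simp⟩
  | insert k S hk ih =>
    intro p hp
    have hq : ∀ i, ∃ q, i ∈ S → p i - p k = (x i - x k) * q := fun i => by
      by_cases hi : i ∈ S
      · obtain ⟨q, hq⟩ := hp i (by simp [hi]) k (by simp)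
        exact ⟨q, fun _ => hq⟩
      · exact ⟨0, fun h => absurd h hi⟩
    choose q hq using hq
    -- The divided differences `q` inherit the divisibility: the prime `x i - x j` divides `(x j - x
    -- k) * (q i - q j)` but not the first factor.
    obtain ⟨Q, hQ, hQe⟩ := ih q fun i hi j hj => by
      rcases eq_or_ne i j with rfl | hij
      · simp
      have hik : i ≠ k := fun h => hk (h ▸ hi)
      have hjk : j ≠ k := fun h => hk (h ▸ hj)
      refine ((hx i j hij).dvd_or_dvd (a := x j - x k) ?_).resolve_left (hx' i j k hij hjk hik)
      have h1 := hp i (by simp [hi]) j (by simp [hj])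
      have h2 : (x j - x k) * (q i - q j) = (p i - p j) - (x i - x j) * q i := by
        linear_combination -(hq i hi) + hq j hj
      rw [h2]
      exact dvd_sub h1 (dvd_mul_right _ _)
    refine ⟨Polynomial.C (p k) + (Polynomial.X - Polynomial.C (x k)) * Q, ?_, fun i hi => ?_⟩
    · rw [Finset.card_insert_of_notMem hk]
      refine lt_of_le_of_lt (Polynomial.degree_add_le _ _) (max_lt ?_ ?_)
      · exact lt_of_le_of_lt Polynomial.degree_C_le (by exact_mod_cast Nat.succ_pos _)
      · rcases eq_or_ne Q 0 with rfl | hQ0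
        · simp
        · rw [Polynomial.degree_eq_natDegree hQ0] at hQ
          have hQ' : Q.natDegree < S.card := by exact_mod_cast hQ
          refine lt_of_le_of_lt (Polynomial.degree_mul_le _ _) ?_
          refine lt_of_le_of_lt (add_le_add (Polynomial.degree_X_sub_C_le _)
            Polynomial.degree_le_natDegree) ?_
          have : 1 + Q.natDegree < S.card + 1 := by omega
          exact_mod_cast this
    · rcases Finset.mem_insert.mp hi with rfl | hi
      · simp
      · simp only [Polynomial.eval_add, Polynomial.eval_C, Polynomial.eval_mul,
          Polynomial.eval_sub, Polynomial.eval_X, hQe i hi, ← hq i hi]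
        ring

/-! ### Logarithmic derivations and the pre-likelihood ideal -/

section General

variable {n : ℕ} {ι : Type*} [Fintype ι]

/-- Modulo `f i`, only the `i`-th Leibniz term survives, and the prime `f i` does not divide its
cofactor. -/
theorem mem_derModule_iff {f : ι → MvPolynomial (Fin n) ℂ} (hf : ∀ i, Prime (f i))
    (hf' : ∀ i j, i ≠ j → ¬ f i ∣ f j)
    (θ : Derivation ℂ (MvPolynomial (Fin n) ℂ) (MvPolynomial (Fin n) ℂ)) :
    θ ∈ derModule f ↔ ∀ i, f i ∣ θ (f i) := by
  classical
  have hprod : θ (∏ i, f i) = ∑ i, (∏ j ∈ Finset.univ.erase i, f j) * θ (f i) := by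
    rw [derivation_prod]
    simp only [smul_eq_mul]
  change θ (∏ i, f i) ∈ Ideal.span {∏ i, f i} ↔ _
  rw [Ideal.mem_span_singleton, hprod]
  constructor
  · intro h i
    have h1 := (Finset.dvd_prod_of_mem f (Finset.mem_univ i)).trans h
    rw [← Finset.add_sum_erase _ _ (Finset.mem_univ i)] at h1
    have h2 : f i ∣ ∑ k ∈ Finset.univ.erase i, (∏ j ∈ Finset.univ.erase k, f j) * θ (f k) :=
      Finset.dvd_sum fun k hk => ((Finset.dvd_prod_of_mem f
        (by simpa using (Finset.ne_of_mem_erase hk).symm)).mul_right _)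
    refine ((hf i).dvd_or_dvd ((dvd_add_left h2).mp h1)).resolve_left fun h3 => ?_
    obtain ⟨j, hj, hij⟩ := (hf i).exists_mem_finset_dvd h3
    exact hf' i j (Finset.ne_of_mem_erase hj).symm hij
  · intro h
    refine Finset.dvd_sum fun i _ => ?_
    rw [← Finset.mul_prod_erase _ _ (Finset.mem_univ i), mul_comm]
    exact mul_dvd_mul_left _ (h i)

theorem mem_logDer_iff (f : ι → MvPolynomial (Fin n) ℂ) (a : ι → MvPolynomial (Fin n) ℂ) :
    a ∈ logDer f ↔ ∃ θ : Derivation ℂ (MvPolynomial (Fin n) ℂ) (MvPolynomial (Fin n) ℂ),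
      ∀ i, θ (f i) = f i * a i := by
  classical
  have hQ : ∀ (v : ι ⊕ Fin n → MvPolynomial (Fin n) ℂ) (i : ι),
      (matrixQ f).mulVec v i =
        f i * v (Sum.inl i) + mkDerivation ℂ (fun j => v (Sum.inr j)) (f i) := by
    intro v i
    have hsum : mkDerivation ℂ (fun j => v (Sum.inr j)) =
        ∑ j, v (Sum.inr j) • pderiv j := MvPolynomial.derivation_ext fun j => by
      simp [derivation_sum_apply, mkDerivation_X, pderiv_X, Pi.single_apply]
    rw [hsum, derivation_sum_apply]
    simp [matrixQ, Matrix.mulVec, dotProduct, Matrix.diagonal_apply, mul_comm]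
  constructor
  · rintro ⟨v, hv, rfl⟩
    -- The sign arises because a kernel vector satisfies `f i * a i + D (f i) = 0`.
    refine ⟨-mkDerivation ℂ (fun j => v (Sum.inr j)), fun i => ?_⟩
    have := congrFun (LinearMap.mem_ker.mp hv) i
    rw [Matrix.mulVecLin_apply, hQ] at this
    simpa [LinearMap.funLeft_apply, neg_eq_iff_add_eq_zero, add_comm] using this
  · rintro ⟨θ, hθ⟩
    refine ⟨Sum.elim a fun j => -θ (X j), LinearMap.mem_ker.mpr (funext fun i => ?_), ?_⟩
    · rw [Matrix.mulVecLin_apply, hQ]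
      have : mkDerivation ℂ (fun j => (Sum.elim a (fun j => -θ (X j)) (Sum.inr j) :
          MvPolynomial (Fin n) ℂ)) = -θ := MvPolynomial.derivation_ext fun j => by
        simp [mkDerivation_X]
      rw [this]
      simp [hθ]
    · ext1 i
      simp [LinearMap.funLeft_apply]

theorem toFrac_injective (n : ℕ) (ι : Type*) : Function.Injective (toFrac n ι) :=
  MvPolynomial.map_injective _ (IsFractionRing.injective _ _)

theorem toFrac_sum_X_mul_C {f : ι → MvPolynomial (Fin n) ℂ} (hf : ∀ i, f i ≠ 0)
    {θ : Derivation ℂ (MvPolynomial (Fin n) ℂ) (MvPolynomial (Fin n) ℂ)}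
    {a : ι → MvPolynomial (Fin n) ℂ} (h : ∀ i, θ (f i) = f i * a i) :
    toFrac n ι (∑ i, X i * C (a i)) = logLikelihoodDeriv f θ := by
  simp only [toFrac, logLikelihoodDeriv, map_sum, map_mul, map_X, map_C]
  refine Finset.sum_congr rfl fun i _ => ?_
  rw [h i, map_mul, mul_div_cancel_left₀]
  simpa using hf i

theorem toFrac_eq_logLikelihoodDeriv_iff {f : ι → MvPolynomial (Fin n) ℂ} (hf : ∀ i, f i ≠ 0)
    {θ : Derivation ℂ (MvPolynomial (Fin n) ℂ) (MvPolynomial (Fin n) ℂ)}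
    {a : ι → MvPolynomial (Fin n) ℂ} (h : ∀ i, θ (f i) = f i * a i)
    (q : MvPolynomial ι (MvPolynomial (Fin n) ℂ)) :
    toFrac n ι q = logLikelihoodDeriv f θ ↔ q = ∑ i, X i * C (a i) := by
  rw [← toFrac_sum_X_mul_C hf h, (toFrac_injective n ι).eq_iff]

/-- The polynomial form of `θ(ℓ)` is unique and `R`-linear in `θ`, so generators of the module give
generators of the ideal. -/
theorem preLikelihoodIdeal_eq_span {f : ι → MvPolynomial (Fin n) ℂ} (hf : ∀ i, f i ≠ 0)
    {S : Set (Derivation ℂ (MvPolynomial (Fin n) ℂ) (MvPolynomial (Fin n) ℂ))}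
    (hS : ∀ θ, θ ∈ Submodule.span (MvPolynomial (Fin n) ℂ) S ↔ ∀ i, f i ∣ θ (f i)) :
    preLikelihoodIdeal f =
      Ideal.span {q | ∃ θ ∈ S, toFrac n ι q = logLikelihoodDeriv f θ} := by
  apply le_antisymm
  · refine Ideal.span_le.mpr ?_
    rintro _ ⟨a, ha, rfl⟩
    obtain ⟨θ, hθ⟩ := (mem_logDer_iff f a).mp ha
    have hmem := (hS θ).mpr fun i => ⟨a i, hθ i⟩
    suffices H : ∀ θ ∈ Submodule.span (MvPolynomial (Fin n) ℂ) S,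
        ∀ q, toFrac n ι q = logLikelihoodDeriv f θ →
          q ∈ Ideal.span {q | ∃ θ ∈ S, toFrac n ι q = logLikelihoodDeriv f θ} from
      H θ hmem _ (toFrac_sum_X_mul_C hf hθ)
    clear! θ a
    intro θ hθ
    induction hθ using Submodule.span_induction with
    | mem θ h => exact fun q hq => Ideal.subset_span ⟨θ, h, hq⟩
    | zero =>
      intro q hq
      have h0 : q = ∑ i, X i * C ((0 : ι → MvPolynomial (Fin n) ℂ) i) :=
        (toFrac_eq_logLikelihoodDeriv_iff hf (by simp) q).mp hq
      simp [h0]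
    | add θ η h1 h2 ih1 ih2 =>
      intro q hq
      choose a ha using (hS θ).mp h1
      choose b hb using (hS η).mp h2
      have h0 : q = ∑ i, X i * C ((a + b) i) :=
        (toFrac_eq_logLikelihoodDeriv_iff hf (by simp [ha, hb, mul_add]) q).mp hq
      have h0' : q = ∑ i, X i * C (a i) + ∑ i, X i * C (b i) := by
        simp [h0, mul_add, Finset.sum_add_distrib]
      rw [h0']
      exact Ideal.add_mem _ (ih1 _ (toFrac_sum_X_mul_C hf ha)) (ih2 _ (toFrac_sum_X_mul_C hf hb))
    | smul c θ h1 ih1 =>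
      intro q hq
      choose a ha using (hS θ).mp h1
      have h0 : q = ∑ i, X i * C ((c • a) i) :=
        (toFrac_eq_logLikelihoodDeriv_iff hf
          (fun i => by simp only [Derivation.smul_apply, Pi.smul_apply, ha, smul_eq_mul]; ring)
          q).mp hq
      have h0' : q = C c * ∑ i, X i * C (a i) := by
        simp [h0, Finset.mul_sum, mul_left_comm]
      rw [h0']
      exact Ideal.mul_mem_left _ _ (ih1 _ (toFrac_sum_X_mul_C hf ha))
  · refine Ideal.span_le.mpr ?_
    rintro q ⟨θ, hθ, hq⟩
    choose a ha using (hS θ).mp (Submodule.subset_span hθ)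
    exact Ideal.subset_span ⟨a, (mem_logDer_iff f a).mpr ⟨θ, ha⟩,
      (toFrac_eq_logLikelihoodDeriv_iff hf ha q).mp hq⟩

end General

/-! ### Graphic arrangements and separators -/

section Graphic

variable {n : ℕ}

theorem graphicArrangement_prime (G : SimpleGraph (Fin n)) (e : OrientedEdge G) :
    Prime (graphicArrangement G e) :=
  prime_X_sub_X e.2.1.ne

theorem graphicArrangement_not_dvd (G : SimpleGraph (Fin n)) (e e' : OrientedEdge G)
    (h : e ≠ e') : ¬ graphicArrangement G e ∣ graphicArrangement G e' := by
  intro hd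
  have h1 := X_sub_X_dvd_X_sub_X_iff.mp hd
  have h2 := e.2.1
  have h3 := e'.2.1
  refine h (Subtype.ext (Prod.ext ?_ ?_)) <;>
  · simp only [Function.update_apply, id] at h1
    split_ifs at h1 <;> omega

theorem forall_graphicArrangement_dvd_iff (G : SimpleGraph (Fin n))
    (θ : Derivation ℂ (MvPolynomial (Fin n) ℂ) (MvPolynomial (Fin n) ℂ)) :
    (∀ e, graphicArrangement G e ∣ θ (graphicArrangement G e)) ↔
      ∀ i j, G.Adj i j → (X i - X j : MvPolynomial (Fin n) ℂ) ∣ θ (X i) - θ (X j) := by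
  constructor
  · intro h i j hij
    rcases lt_or_gt_of_ne hij.ne with hlt | hlt
    · simpa [graphicArrangement] using h ⟨(i, j), hlt, hij⟩
    · have := h ⟨(j, i), hlt, hij.symm⟩
      simp only [graphicArrangement, map_sub] at this
      rwa [← neg_dvd, ← dvd_neg, neg_sub, neg_sub] at this
  · rintro h ⟨⟨i, j⟩, -, hij⟩
    simpa [graphicArrangement] using h i j hij

theorem saitoDerivation_X (k : ℕ) (i : Fin n) : saitoDerivation n k (X i) = X i ^ k := by
  simp [saitoDerivation, derivation_sum_apply, pderiv_X, Pi.single_apply]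

open Classical in
/-- The derivation `∑_{i ∈ S} ∏_{t ∈ T} (x_i - x_t) ∂_i` for a set of vertices `S`. -/
noncomputable def vertexSetDerivation (T : Finset (Fin n)) (S : Set (Fin n)) :
    Derivation ℂ (MvPolynomial (Fin n) ℂ) (MvPolynomial (Fin n) ℂ) :=
  ∑ i : Fin n with i ∈ S, (∏ t ∈ T, (X i - X t : MvPolynomial (Fin n) ℂ)) • pderiv i

open Classical in
theorem vertexSetDerivation_X (T : Finset (Fin n)) (S : Set (Fin n)) (i : Fin n) :
    vertexSetDerivation T S (X i) = if i ∈ S then ∏ t ∈ T, (X i - X t) else 0 := by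
  rw [vertexSetDerivation, derivation_sum_apply, Finset.sum_filter]
  simp only [Derivation.smul_apply, pderiv_X, Pi.single_apply, smul_eq_mul, mul_ite, mul_one,
    mul_zero]
  rw [Finset.sum_eq_single i (fun k _ hk => by simp [hk.symm]) (by simp)]
  simp

theorem separatorDerivation_eq (G : SimpleGraph (Fin n)) (T : Finset (Fin n))
    (C : (G.induce ((T : Set (Fin n))ᶜ)).ConnectedComponent) :
    separatorDerivation G T C = vertexSetDerivation T (Subtype.val '' C.supp) :=
  rfl

/-- If an endpoint lies in `T`, its coefficient vanishes and the other one has the edge form as a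
factor or is zero. Otherwise `S` contains both endpoints or neither. -/
theorem vertexSetDerivation_dvd (G : SimpleGraph (Fin n)) (T : Finset (Fin n)) (S : Set (Fin n))
    (hS : ∀ i j, i ∉ T → j ∉ T → G.Adj i j → i ∈ S → j ∈ S) {i j : Fin n} (hij : G.Adj i j) :
    (X i - X j : MvPolynomial (Fin n) ℂ) ∣
      vertexSetDerivation T S (X i) - vertexSetDerivation T S (X j) := by
  classical
  have hzero : ∀ i ∈ T, vertexSetDerivation T S (X i) = 0 := fun i hi => by
    rw [vertexSetDerivation_X, Finset.prod_eq_zero hi (sub_self _), ite_self]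
  have hdvd : ∀ i, ∀ j ∈ T, (X i - X j : MvPolynomial (Fin n) ℂ) ∣ vertexSetDerivation T S (X i) :=
    fun i j hj => by
      rw [vertexSetDerivation_X]
      split_ifs
      · exact Finset.dvd_prod_of_mem (fun t => (X i - X t : MvPolynomial (Fin n) ℂ)) hj
      · exact dvd_zero _
  by_cases hj : j ∈ T
  · rw [hzero j hj, sub_zero]
    exact hdvd i j hj
  by_cases hi : i ∈ T
  · rw [hzero i hi, zero_sub, dvd_neg, ← neg_dvd, neg_sub]
    exact hdvd j i hi
  have hiff : i ∈ S ↔ j ∈ S := ⟨hS i j hi hj hij, hS j i hj hi hij.symm⟩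
  simp only [vertexSetDerivation_X, hiff]
  split_ifs
  · rw [X_sub_X_dvd_iff, map_sub, map_prod, map_prod, sub_eq_zero]
    refine Finset.prod_congr rfl fun t _ => ?_
    rw [map_sub, map_sub]
    congr 1
    simp [hij.ne']
  · simp

theorem mem_image_supp_iff {G : SimpleGraph (Fin n)} {T : Finset (Fin n)}
    (C : (G.induce ((T : Set (Fin n))ᶜ)).ConnectedComponent) (i : Fin n) :
    i ∈ Subtype.val '' C.supp ↔
      ∃ h : i ∉ T, (G.induce ((T : Set (Fin n))ᶜ)).connectedComponentMk ⟨i, by simpa⟩ = C := by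
  simp [SimpleGraph.ConnectedComponent.mem_supp_iff]

theorem image_supp_closed {G : SimpleGraph (Fin n)} {T : Finset (Fin n)}
    (C : (G.induce ((T : Set (Fin n))ᶜ)).ConnectedComponent) (i j : Fin n) (_ : i ∉ T)
    (hj : j ∉ T) (hij : G.Adj i j) (h : i ∈ Subtype.val '' C.supp) :
    j ∈ Subtype.val '' C.supp := by
  rw [mem_image_supp_iff] at h ⊢
  obtain ⟨_, rfl⟩ := h
  refine ⟨hj, SimpleGraph.ConnectedComponent.sound (SimpleGraph.Adj.reachable ?_)⟩
  simpa using hij.symm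

theorem dvd_of_mem_generatingDerivations {G : SimpleGraph (Fin n)}
    {θ : Derivation ℂ (MvPolynomial (Fin n) ℂ) (MvPolynomial (Fin n) ℂ)}
    (hθ : θ ∈ generatingDerivations G) {i j : Fin n} (hij : G.Adj i j) :
    (X i - X j : MvPolynomial (Fin n) ℂ) ∣ θ (X i) - θ (X j) := by
  rcases hθ with ⟨k, -, rfl⟩ | ⟨T, -, C, rfl⟩
  · rw [saitoDerivation_X, saitoDerivation_X]
    exact sub_dvd_pow_sub_pow _ _ _
  · rw [separatorDerivation_eq]
    exact vertexSetDerivation_dvd G T _ (image_supp_closed C) hij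

theorem dvd_of_mem_span_generatingDerivations {G : SimpleGraph (Fin n)}
    {θ : Derivation ℂ (MvPolynomial (Fin n) ℂ) (MvPolynomial (Fin n) ℂ)}
    (hθ : θ ∈ Submodule.span (MvPolynomial (Fin n) ℂ) (generatingDerivations G)) {i j : Fin n}
    (hij : G.Adj i j) : (X i - X j : MvPolynomial (Fin n) ℂ) ∣ θ (X i) - θ (X j) := by
  induction hθ using Submodule.span_induction with
  | mem η h => exact dvd_of_mem_generatingDerivations h hij
  | zero => simp
  | add η₁ η₂ _ _ h1 h2 => simpa [add_sub_add_comm] using dvd_add h1 h2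
  | smul c η _ h => simpa [mul_sub] using h.mul_left c

/-- For a separator `T`, the derivation of a union of components of `G \ T` is the sum of the
derivations of these components. -/
theorem vertexSetDerivation_mem_span {G : SimpleGraph (Fin n)} {T : Finset (Fin n)}
    (hT : IsSeparator G T) {S : Set (Fin n)} (hST : ∀ i ∈ S, i ∉ T)
    (hS : ∀ i j, i ∉ T → j ∉ T → G.Adj i j → i ∈ S → j ∈ S) :
    vertexSetDerivation T S ∈
      Submodule.span (MvPolynomial (Fin n) ℂ) (generatingDerivations G) := by
  classical
  have hreach : ∀ u v : ((T : Set (Fin n))ᶜ : Set (Fin n)),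
      (G.induce ((T : Set (Fin n))ᶜ)).Reachable u v → u.1 ∈ S → v.1 ∈ S := by
    rintro u v ⟨w⟩
    induction w with
    | nil => exact id
    | @cons a b _ hab _ ih =>
      exact fun ha => ih (hS _ _ a.2 b.2 hab ha)
  have hsum : vertexSetDerivation T S =
      ∑ C : (G.induce ((T : Set (Fin n))ᶜ)).ConnectedComponent with Subtype.val '' C.supp ⊆ S,
        separatorDerivation G T C := by
    refine MvPolynomial.derivation_ext fun i => ?_
    rw [derivation_sum_apply, vertexSetDerivation_X]
    simp only [separatorDerivation_eq, vertexSetDerivation_X]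
    split_ifs with hi
    · have hiT := hST i hi
      have hsub : Subtype.val '' ((G.induce ((T : Set (Fin n))ᶜ)).connectedComponentMk
          ⟨i, by simpa⟩).supp ⊆ S := by
        rintro _ ⟨v, hv, rfl⟩
        exact hreach _ v (SimpleGraph.ConnectedComponent.exact hv).symm hi
      rw [Finset.sum_eq_single_of_mem _ (by simpa only [Finset.mem_filter_univ] using hsub)]
      · rw [if_pos ((mem_image_supp_iff _ _).mpr ⟨hiT, rfl⟩)]
      · intro C _ hC
        refine if_neg fun h => hC ?_
        obtain ⟨_, rfl⟩ := (mem_image_supp_iff _ _).mp h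
        rfl
    · refine (Finset.sum_eq_zero fun C hC => if_neg fun h => hi ?_).symm
      exact (Finset.mem_filter_univ _).mp hC h
  rw [hsum]
  exact Submodule.sum_mem _ fun C _ => Submodule.subset_span (Or.inr ⟨T, hT, C, rfl⟩)

/-- A separator of `H` also separates the smaller graph `G`, and a component of `H \ T` is a union
of components of `G \ T`. -/
theorem span_generatingDerivations_anti {G H : SimpleGraph (Fin n)} (h : G ≤ H) :
    Submodule.span (MvPolynomial (Fin n) ℂ) (generatingDerivations H) ≤
      Submodule.span (MvPolynomial (Fin n) ℂ) (generatingDerivations G) := by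
  rw [Submodule.span_le]
  rintro _ (⟨k, hk, rfl⟩ | ⟨T, hT, C, rfl⟩)
  · exact Submodule.subset_span (Or.inl ⟨k, hk, rfl⟩)
  · rw [separatorDerivation_eq]
    refine vertexSetDerivation_mem_span (fun hG => hT (hG.mono fun _ _ hab => h hab)) ?_
      fun i j hi hj hij => image_supp_closed C i j hi hj (h hij)
    exact fun i hi => ((mem_image_supp_iff C i).mp hi).1

theorem mem_span_saitoDerivation
    {θ : Derivation ℂ (MvPolynomial (Fin n) ℂ) (MvPolynomial (Fin n) ℂ)}
    (hθ : ∀ i j, (X i - X j : MvPolynomial (Fin n) ℂ) ∣ θ (X i) - θ (X j)) :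
    θ ∈ Submodule.span (MvPolynomial (Fin n) ℂ)
      {η | ∃ k < n, η = saitoDerivation n k} := by
  obtain ⟨P, hP, hPe⟩ := exists_interpolating_polynomial
    (fun i : Fin n => (X i : MvPolynomial (Fin n) ℂ)) (fun i j h => prime_X_sub_X h)
    (fun i j k hij hjk hik h => by
      have := X_sub_X_dvd_X_sub_X_iff.mp h
      simp [hij.symm, hik.symm, hjk] at this)
    Finset.univ (fun i => θ (X i)) (fun i _ j _ => hθ i j)
  rw [Finset.card_univ, Fintype.card_fin] at hP
  have hsum : θ = ∑ k ∈ Finset.range n, P.coeff k • saitoDerivation n k := by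
    refine MvPolynomial.derivation_ext fun i => ?_
    have hn : n ≠ 0 := fun h => (h ▸ i).elim0
    have hdeg : P.natDegree < n := by
      rcases eq_or_ne P 0 with rfl | hP0
      · simpa using Nat.pos_of_ne_zero hn
      · exact (Polynomial.natDegree_lt_iff_degree_lt hP0).mpr hP
    rw [← hPe i (Finset.mem_univ i), Polynomial.eval_eq_sum_range'
      hdeg, derivation_sum_apply]
    simp [saitoDerivation_X]
  rw [hsum]
  exact Submodule.sum_mem _ fun k hk => Submodule.smul_mem _ _
    (Submodule.subset_span ⟨k, Finset.mem_range.mp hk, rfl⟩)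

/-- Every monomial of `ψ(θ(x_b) - θ(x_a))`, where `ψ` identifies `x_a` with `x_b` and moves the
origin to `x_b`, is divisible by all variables of a separator of `a` and `b`. -/
theorem not_reachable_of_mem_support {G : SimpleGraph (Fin n)} {a b : Fin n}
    {θ : Derivation ℂ (MvPolynomial (Fin n) ℂ) (MvPolynomial (Fin n) ℂ)}
    (hθ : ∀ i j, G.Adj i j → (X i - X j : MvPolynomial (Fin n) ℂ) ∣ θ (X i) - θ (X j))
    {T : Finset (Fin n)} {m : Fin n →₀ ℕ} (hmT : ∀ t, t ≠ a → t ≠ b → m t ≠ 0 → t ∈ T)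
    (hm : m ∈ (aeval (fun t => if t = a ∨ t = b then X b else X b - X t)
      (θ (X b) - θ (X a)) : MvPolynomial (Fin n) ℂ).support)
    (ha : a ∈ (T : Set (Fin n))ᶜ) (hb : b ∈ (T : Set (Fin n))ᶜ) :
    ¬ (G.induce ((T : Set (Fin n))ᶜ)).Reachable ⟨b, hb⟩ ⟨a, ha⟩ := by
  intro hr
  set ψ : MvPolynomial (Fin n) ℂ →ₐ[ℂ] MvPolynomial (Fin n) ℂ :=
    aeval (fun t => if t = a ∨ t = b then X b else X b - X t) with hψ
  -- Modulo `I`, `ψ` sends all variables outside `T` to `x_b`, so differences telescope to zero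
  -- along paths avoiding `T`.
  let I : Ideal (MvPolynomial (Fin n) ℂ) := Ideal.span (X '' {t | t ∉ T ∧ t ≠ a ∧ t ≠ b})
  have hX : ∀ i, i ∉ T → ψ (X i) - X b ∈ I := by
    intro i hi
    by_cases h : i = a ∨ i = b
    · simp [hψ, h]
    · have : (X i : MvPolynomial (Fin n) ℂ) ∈ I :=
        Ideal.subset_span ⟨i, ⟨hi, not_or.mp h⟩, rfl⟩
      simpa [hψ, h] using this
  have hmem : ∀ u v : ((T : Set (Fin n))ᶜ : Set (Fin n)),
      (G.induce ((T : Set (Fin n))ᶜ)).Reachable u v → ψ (θ (X u.1) - θ (X v.1)) ∈ I := by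
    rintro u v ⟨w⟩
    induction w with
    | nil => simp
    | @cons u v w huv _ ih =>
      have h1 : ψ (θ (X u.1) - θ (X v.1)) ∈ I := by
        obtain ⟨q, hq⟩ := hθ u v (by simpa using huv)
        rw [hq, map_mul, map_sub]
        refine Ideal.mul_mem_right _ _ ?_
        simpa using I.sub_mem (hX u u.2) (hX v v.2)
      simpa using I.add_mem h1 ih
  -- Every monomial of an element of `I` contains a generating variable, but `m` has none.
  obtain ⟨t, ⟨htT, hta, htb⟩, ht⟩ := mem_ideal_span_X_image.mp (hmem _ _ hr) m hm
  exact htT (hmT t hta htb ht)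

theorem exists_separator_correction {G : SimpleGraph (Fin n)} {a b : Fin n}
    {θ : Derivation ℂ (MvPolynomial (Fin n) ℂ) (MvPolynomial (Fin n) ℂ)}
    (hθ : ∀ i j, G.Adj i j → (X i - X j : MvPolynomial (Fin n) ℂ) ∣ θ (X i) - θ (X j)) :
    ∃ η ∈ Submodule.span (MvPolynomial (Fin n) ℂ) (generatingDerivations G),
      (X a - X b : MvPolynomial (Fin n) ℂ) ∣ (θ (X b) - θ (X a)) - (η (X b) - η (X a)) := by
  classical
  set ψ : MvPolynomial (Fin n) ℂ →ₐ[ℂ] MvPolynomial (Fin n) ℂ :=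
    aeval (fun t => if t = a ∨ t = b then X b else X b - X t) with hψ
  -- `χ` undoes `ψ` modulo `x_a - x_b`.
  set χ : MvPolynomial (Fin n) ℂ →ₐ[ℂ] MvPolynomial (Fin n) ℂ :=
    aeval (fun t => if t = b then X b else X b - X t) with hχ
  set q := ψ (θ (X b) - θ (X a)) with hq
  have hmon : ∀ m ∈ q.support, ∃ η ∈ Submodule.span (MvPolynomial (Fin n) ℂ)
      (generatingDerivations G), η (X b) - η (X a) = χ (monomial m (coeff m q)) := by
    intro m hm
    let T : Finset (Fin n) := {t | t ≠ a ∧ t ≠ b ∧ m t ≠ 0}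
    have ha : a ∈ (T : Set (Fin n))ᶜ := by simp [T]
    have hb : b ∈ (T : Set (Fin n))ᶜ := by simp [T]
    have hnr := not_reachable_of_mem_support hθ (T := T) (m := m)
      (fun t h1 h2 h3 => by simp [T, h1, h2, h3]) hm ha hb
    have hdvd : (∏ t ∈ T, X t : MvPolynomial (Fin n) ℂ) ∣ monomial m (coeff m q) := by
      rw [monomial_eq, Finsupp.prod_fintype _ _ (fun _ => pow_zero _)]
      refine Dvd.dvd.mul_left ((Finset.prod_dvd_prod_of_dvd _ _ fun t ht => ?_).trans
        (Finset.prod_dvd_prod_of_subset _ _ _ (Finset.subset_univ T))) _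
      exact dvd_pow_self _ (by simp [T] at ht; exact ht.2.2)
    obtain ⟨c, hc⟩ := hdvd
    -- For the component of `b`, the derivation takes `x_b` to `∏ (x_b - x_t) = χ (∏ x_t)` and kills
    -- `x_a`.
    refine ⟨χ c • separatorDerivation G T (SimpleGraph.connectedComponentMk _ ⟨b, hb⟩),
      Submodule.smul_mem _ _ (Submodule.subset_span (Or.inr ⟨T, fun h => hnr (h _ _), _, rfl⟩)), ?_⟩
    rw [Derivation.smul_apply, Derivation.smul_apply, separatorDerivation_eq,
      vertexSetDerivation_X, vertexSetDerivation_X, if_pos, if_neg, hc, map_mul, map_prod]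
    · have : ∀ t ∈ T, χ (X t) = X b - X t := fun t ht => by
        have : t ≠ b := by simp [T] at ht; exact ht.2.1
        simp [hχ, this]
      rw [Finset.prod_congr rfl this, smul_zero, sub_zero, smul_eq_mul, mul_comm]
    · intro h
      obtain ⟨_, h⟩ := (mem_image_supp_iff _ _).mp h
      exact hnr (SimpleGraph.ConnectedComponent.exact h).symm
    · exact (mem_image_supp_iff _ _).mpr ⟨by simpa using hb, rfl⟩
  choose! η hη hηX using hmon
  refine ⟨∑ m ∈ q.support, η m, Submodule.sum_mem _ hη, ?_⟩
  have hsum : (∑ m ∈ q.support, η m) (X b) - (∑ m ∈ q.support, η m) (X a) = χ q := by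
    rw [derivation_sum_apply, derivation_sum_apply, ← Finset.sum_sub_distrib,
      Finset.sum_congr rfl hηX, ← map_sum, ← as_sum]
  rw [hsum]
  refine X_sub_X_dvd_sub_of_algHom (χ.comp ψ) (fun i => ?_) _
  by_cases hib : i = b
  · simp [hχ, hψ, hib]
  by_cases hia : i = a
  · simp [hχ, hψ, hia]
  · simp [hχ, hψ, hia, hib]

theorem mem_span_generatingDerivations (G : SimpleGraph (Fin n)) :
    ∀ θ : Derivation ℂ (MvPolynomial (Fin n) ℂ) (MvPolynomial (Fin n) ℂ),
      (∀ i j, G.Adj i j → (X i - X j : MvPolynomial (Fin n) ℂ) ∣ θ (X i) - θ (X j)) →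
      θ ∈ Submodule.span (MvPolynomial (Fin n) ℂ) (generatingDerivations G) := by
  -- The induction hypothesis concerns graphs with more edges.
  induction G using WellFoundedGT.induction with
  | ind G ih =>
    intro θ hθ
    by_cases hG : ∀ i j, i ≠ j → G.Adj i j
    · refine Submodule.span_mono Set.subset_union_left (mem_span_saitoDerivation fun i j => ?_)
      rcases eq_or_ne i j with rfl | hij
      · simp
      · exact hθ i j (hG i j hij)
    · push Not at hG
      obtain ⟨a, b, hab, hnadj⟩ := hG
      obtain ⟨η, hη, hdvd⟩ := exists_separator_correction (a := a) (b := b) hθ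
      have hlt : G < G ⊔ SimpleGraph.edge a b :=
        lt_of_le_of_ne le_sup_left fun h => hnadj (by
          rw [h]; simp [SimpleGraph.edge_adj, hab])
      have := span_generatingDerivations_anti hlt.le (ih _ hlt (θ - η) fun i j hij => ?_)
      · simpa using Submodule.add_mem _ this hη
      · rw [Derivation.sub_apply, Derivation.sub_apply, sub_sub_sub_comm]
        rcases hij with hij | hij
        · exact dvd_sub (hθ i j hij) (dvd_of_mem_span_generatingDerivations hη hij)
        · rw [SimpleGraph.edge_adj] at hij
          rcases hij.1 with ⟨rfl, rfl⟩ | ⟨rfl, rfl⟩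
          · rw [← dvd_neg]
            convert hdvd using 1
            ring
          · rw [← neg_dvd, neg_sub]
            exact hdvd

theorem mem_span_generatingDerivations_iff (G : SimpleGraph (Fin n))
    (θ : Derivation ℂ (MvPolynomial (Fin n) ℂ) (MvPolynomial (Fin n) ℂ)) :
    θ ∈ Submodule.span (MvPolynomial (Fin n) ℂ) (generatingDerivations G) ↔
      ∀ e, graphicArrangement G e ∣ θ (graphicArrangement G e) := by
  rw [forall_graphicArrangement_dvd_iff]
  refine ⟨fun h i j hij => dvd_of_mem_span_generatingDerivations h hij, mem_span_generatingDerivations G θ⟩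

end Graphic

end LikelihoodArrangement

theorem mainTheorem10 (n : ℕ) (G : SimpleGraph (Fin n)) :
    Submodule.span (MvPolynomial (Fin n) ℂ) (LikelihoodArrangement.generatingDerivations G) =
        LikelihoodArrangement.derModule (LikelihoodArrangement.graphicArrangement G) ∧
      (∀ θ ∈ LikelihoodArrangement.generatingDerivations G,
        ∃! q : MvPolynomial (LikelihoodArrangement.OrientedEdge G) (MvPolynomial (Fin n) ℂ),
          LikelihoodArrangement.toFrac n (LikelihoodArrangement.OrientedEdge G) q =
            LikelihoodArrangement.logLikelihoodDeriv
              (LikelihoodArrangement.graphicArrangement G) θ) ∧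
      LikelihoodArrangement.preLikelihoodIdeal (LikelihoodArrangement.graphicArrangement G) =
        Ideal.span {q | ∃ θ ∈ LikelihoodArrangement.generatingDerivations G,
          LikelihoodArrangement.toFrac n (LikelihoodArrangement.OrientedEdge G) q =
            LikelihoodArrangement.logLikelihoodDeriv
              (LikelihoodArrangement.graphicArrangement G) θ} := by
  have hne e := (LikelihoodArrangement.graphicArrangement_prime G e).ne_zero
  have hmem := LikelihoodArrangement.mem_span_generatingDerivations_iff G
  refine ⟨?_, fun θ hθ => ?_, LikelihoodArrangement.preLikelihoodIdeal_eq_span hne hmem⟩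
  · ext θ
    rw [hmem, LikelihoodArrangement.mem_derModule_iff
      (LikelihoodArrangement.graphicArrangement_prime G)
      (LikelihoodArrangement.graphicArrangement_not_dvd G)]
  · choose a ha using (hmem θ).mp (Submodule.subset_span hθ)
    exact ⟨_, LikelihoodArrangement.toFrac_sum_X_mul_C hne ha,
      fun q => (LikelihoodArrangement.toFrac_eq_logLikelihoodDeriv_iff hne ha q).mp⟩
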